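/- Let $T$ be a torus with one puncture, equipped with a complete hyperbolic metric (of curvature $-1$) of finite area. The orientation-preserving isometry group of $T$ contains a unique nontrivial involution, the elliptic involution, and its fixed points on $T$ are called Weierstrass points. Let $\alpha$ and $\beta$ be simple closed geodesics on $T$, of lengths $\ell(\alpha)$ and $\ell(\beta)$, which pass through a common Weierstrass point $w$ and are associated generators, that is, the homotopy classes of the loops $\alpha$ and $\beta$ based at $w$ generate $\pi_1(T,w)$. Let $\angle(\alpha,\beta)$ be the angle between $\alpha$ and $\beta$ at $w$. Then $$\sinh\frac{\ell(\alpha)}{2}\,\sinh\frac{\ell(\beta)}{2}\,\sin\angle(\alpha,\beta)=1.$$ -/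

import Mathlib

open scoped UpperHalfPlane MatrixGroups

namespace PuncturedTorus

/-- The surface `Γ \ ℍ`, with its quotient topology. Here `ℍ` carries the hyperbolic metric of
curvature `-1`, on which `SL(2, ℝ)` acts by orientation-preserving isometries. -/
abbrev Surface (Γ : Subgroup SL(2, ℝ)) : Type := MulAction.orbitRel.Quotient Γ ℍ

/-- The universal covering map `ℍ → Γ \ ℍ`. -/
noncomputable def proj (Γ : Subgroup SL(2, ℝ)) (z : ℍ) : Surface Γ := Quotient.mk _ z

/-- `Γ \ ℍ` is a torus with one puncture equipped with a complete hyperbolic metric of finite area,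
and `Γ` is its group of deck transformations, that is, its fundamental group.
(The fundamental group is free, so the holonomy group in `PSL(2, ℝ)` of any such surface lifts
isomorphically to a subgroup of `SL(2, ℝ)`.) -/
structure IsHyperbolicPuncturedTorus (Γ : Subgroup SL(2, ℝ)) : Prop where
  /-- `Γ` acts freely. -/
  free : ∀ g ∈ Γ, ∀ z : ℍ, g • z = z → g = 1
  properlyDiscontinuous : ProperlyDiscontinuousSMul Γ ℍ
  /-- The quotient is homeomorphic to a torus minus one point. -/
  homeomorphic : Nonempty (Surface Γ ≃ₜ {p : Circle × Circle // p ≠ 1})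
  /-- The quotient has finite hyperbolic area; `volume` on `ℍ` is `dx dy / y ^ 2`. -/
  finiteArea : ∃ D : Set ℍ, MeasureTheory.IsFundamentalDomain Γ D MeasureTheory.volume ∧
    MeasureTheory.volume D < ⊤

/-- `c : ℝ → Γ \ ℍ`, parametrized by arc length, is a geodesic and `a : ℝ → ℍ` is a lift of it.
The geodesic lines of `ℍ` with arc length parameter are exactly the isometric embeddings of `ℝ`. -/
structure IsGeodesicLift (Γ : Subgroup SL(2, ℝ)) (c : ℝ → Surface Γ) (a : ℝ → ℍ) : Prop where
  isometry : Isometry a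
  proj_eq : ∀ r, proj Γ (a r) = c r

/-- `c : ℝ → Γ \ ℍ` is the arc length parametrization of a simple closed geodesic of length `l`. -/
structure IsSimpleClosedGeodesic (Γ : Subgroup SL(2, ℝ)) (c : ℝ → Surface Γ) (l : ℝ) : Prop where
  length_pos : 0 < l
  geodesic : ∃ a : ℝ → ℍ, IsGeodesicLift Γ c a
  closed : ∀ r, c (r + l) = c r
  simple : Set.InjOn c (Set.Ico 0 l)

/-- `J` is the elliptic involution of the punctured torus `Γ \ ℍ`: its nontrivial
orientation-preserving isometric involution. It is unique, because the orientation-preserving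
isometries of a once-punctured torus fix the cusp and form a finite cyclic group. -/
structure IsEllipticInvolution (Γ : Subgroup SL(2, ℝ)) (J : Surface Γ → Surface Γ) : Prop where
  isometric : ∃ j : SL(2, ℝ), ∀ z : ℍ, J (proj Γ z) = proj Γ (j • z)
  involutive : Function.Involutive J
  nontrivial : J ≠ id

/-- The Weierstrass points of the punctured torus (other than the cusp, which is not a point of
the surface) are the fixed points of the elliptic involution. -/
def IsWeierstrassPoint (Γ : Subgroup SL(2, ℝ)) (w : Surface Γ) : Prop :=
  ∃ J : Surface Γ → Surface Γ, IsEllipticInvolution Γ J ∧ J w = w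

/-- The angle between the tangent vectors of the curves `a` at time `s` and `b` at time `t`, meant
for `a s = b t`. The hyperbolic metric is conformal to the Euclidean one, so this is the
Euclidean angle in `ℂ`. -/
noncomputable def angleAt (a : ℝ → ℍ) (s : ℝ) (b : ℝ → ℍ) (t : ℝ) : ℝ :=
  InnerProductGeometry.angle (deriv (fun r : ℝ => (a r : ℂ)) s) (deriv (fun r : ℝ => (b r : ℂ)) t)

/-- Let `a`, `b` be lifts, through a common point `p`, of closed geodesics of lengths `la`, `lb` on
`Γ \ ℍ`, so that they are based at the image `w` of `p`. The base point `p` identifies `Γ` with the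
fundamental group of `Γ \ ℍ` at `w`, and the classes of the two closed geodesics are the deck
transformations `A` and `B` that translate `a` by `la` and `b` by `lb`. The closed geodesics
are associated generators if these two classes generate the fundamental group. -/
def AreAssociatedGenerators (Γ : Subgroup SL(2, ℝ)) (a : ℝ → ℍ) (la : ℝ) (b : ℝ → ℍ) (lb : ℝ) :
    Prop :=
  ∃ A ∈ Γ, ∃ B ∈ Γ, (∀ r, A • a r = a (r + la)) ∧ (∀ r, B • b r = b (r + lb)) ∧
    Subgroup.closure {A, B} = Γ

end PuncturedTorus

/-! Move the common point of the two lifts to i. The generators A and B then act as translations M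
and N by ℓ(α) and ℓ(β) along geodesics through i with unit directions e and f, and the squared sine
of the angle is (e × f)². Let S be the square of the left-hand side. A matrix computation
(`trace_commutator_boost`) gives tr [M, N] = 2 - 4S, so the claim S = 1 says that the commutator,
the loop around the puncture, has trace -2 and is parabolic. All other values of S are excluded.

If S = 0, both axes coincide and Γ translates along a single line. A thin strip across that line
injects into the quotient and has infinite area (`cross_ne_zero`).

If 0 < S < 1, the commutator is elliptic and has a fixed point in ℍ, although Γ acts freely
(`one_le_sinh_mul_sinh_sq`).

If S > 1, A and B play ping-pong with four disjoint half-planes whose complement contains a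
neighbourhood of an ideal point. This neighbourhood injects into the quotient and has infinite area
(`sinh_mul_sinh_sq_le_one`).

Both area arguments rest on `exists_ne_one_of_finiteArea`. As lengths are positive and the sine is
nonnegative, S = 1 gives the formula without the square. -/

namespace PuncturedTorus

/-! ### Hyperboloid coordinates and the action of SL(2, ℝ) on them -/

/-- The time coordinate of a point of `ℍ` in the hyperboloid model. -/
noncomputable def hypT (z : ℍ) : ℝ := (z.re ^ 2 + z.im ^ 2 + 1) / (2 * z.im)

/-- The first space coordinate of a point of `ℍ` in the hyperboloid model. -/
noncomputable def hypU (z : ℍ) : ℝ := (z.re ^ 2 + z.im ^ 2 - 1) / (2 * z.im)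

/-- The second space coordinate of a point of `ℍ` in the hyperboloid model. -/
noncomputable def hypV (z : ℍ) : ℝ := z.re / z.im

lemma hypT_pos (z : ℍ) : 0 < hypT z := by
  have := z.im_pos
  unfold hypT; positivity

lemma hypT_sq (z : ℍ) : hypT z ^ 2 = 1 + hypU z ^ 2 + hypV z ^ 2 := by
  have := z.im_ne_zero
  unfold hypT hypU hypV; field_simp; ring

lemma hypT_sub_hypU (z : ℍ) : hypT z - hypU z = 1 / z.im := by
  have := z.im_ne_zero
  unfold hypT hypU; field_simp; ring

lemma coe_eq_hyp (z : ℍ) :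
    (z : ℂ) = (hypV z + Complex.I) / ((hypT z - hypU z : ℝ) : ℂ) := by
  have h := z.im_ne_zero
  have h' : ((z.im : ℝ) : ℂ) ≠ 0 := by exact_mod_cast h
  rw [hypT_sub_hypU, hypV]
  push_cast
  field_simp
  conv_lhs => rw [← Complex.re_add_im (z : ℂ)]
  simp [mul_comm]

lemma hyp_ext {z w : ℍ} (hT : hypT z = hypT w) (hU : hypU z = hypU w) (hV : hypV z = hypV w) :
    z = w := by
  apply UpperHalfPlane.ext
  rw [coe_eq_hyp, coe_eq_hyp, hT, hU, hV]

lemma cosh_dist_eq_hyp (z w : ℍ) :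
    Real.cosh (dist z w) = hypT z * hypT w - hypU z * hypU w - hypV z * hypV w := by
  have := z.im_ne_zero
  have := w.im_ne_zero
  rw [UpperHalfPlane.cosh_dist', hypT, hypT, hypU, hypU, hypV, hypV]
  field_simp; ring

@[simp] lemma hypT_I : hypT UpperHalfPlane.I = 1 := by simp [hypT]
@[simp] lemma hypU_I : hypU UpperHalfPlane.I = 0 := by simp [hypU]
@[simp] lemma hypV_I : hypV UpperHalfPlane.I = 0 := by simp [hypV]

lemma denom_sq_pos (g : SL(2, ℝ)) (z : ℍ) :
    0 < (g 1 0 * z.re + g 1 1) ^ 2 + (g 1 0 * z.im) ^ 2 := by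
  have hd := g.det_coe
  rw [Matrix.det_fin_two] at hd
  by_cases hc : g 1 0 = 0
  · have : g 1 1 ≠ 0 := by intro h; simp [h, hc] at hd
    rw [hc, zero_mul, zero_add, zero_mul]; positivity
  · exact add_pos_of_nonneg_of_pos (sq_nonneg _)
      (sq_pos_of_ne_zero (mul_ne_zero hc z.im_ne_zero))

lemma im_smul_eq (g : SL(2, ℝ)) (z : ℍ) :
    (g • z).im = z.im / ((g 1 0 * z.re + g 1 1) ^ 2 + (g 1 0 * z.im) ^ 2) := by
  have hd := g.det_coe
  rw [Matrix.det_fin_two] at hd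
  have h := congrArg Complex.im (UpperHalfPlane.coe_specialLinearGroup_apply g z)
  rw [Complex.div_im] at h
  simp [Complex.normSq_apply] at h
  rw [h, ← sub_div, ← pow_two, ← pow_two]
  congr 1
  linear_combination z.im * hd

lemma re_smul_eq (g : SL(2, ℝ)) (z : ℍ) :
    (g • z).re = ((g 0 0 * z.re + g 0 1) * (g 1 0 * z.re + g 1 1) + g 0 0 * g 1 0 * z.im ^ 2) /
      ((g 1 0 * z.re + g 1 1) ^ 2 + (g 1 0 * z.im) ^ 2) := by
  have h := congrArg Complex.re (UpperHalfPlane.coe_specialLinearGroup_apply g z)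
  rw [Complex.div_re] at h
  simp [Complex.normSq_apply] at h
  rw [h, ← add_div, ← pow_two, ← pow_two]
  congr 1
  ring

/-- The coordinates are linear combinations of 1/y, x/y and |z|²/y. In each of these the factor |cz
+ d|² cancels after the Möbius map, which leaves a linear action with coefficients quadratic in the
entries of `g`. -/
lemma hyp_smul (g : SL(2, ℝ)) (z : ℍ) :
    hypT (g • z) = ((g 0 0 ^ 2 + g 0 1 ^ 2 + g 1 0 ^ 2 + g 1 1 ^ 2) * hypT z +
      (g 0 0 ^ 2 - g 0 1 ^ 2 + g 1 0 ^ 2 - g 1 1 ^ 2) * hypU z +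
      2 * (g 0 0 * g 0 1 + g 1 0 * g 1 1) * hypV z) / 2 ∧
    hypU (g • z) = ((g 0 0 ^ 2 + g 0 1 ^ 2 - g 1 0 ^ 2 - g 1 1 ^ 2) * hypT z +
      (g 0 0 ^ 2 - g 0 1 ^ 2 - g 1 0 ^ 2 + g 1 1 ^ 2) * hypU z +
      2 * (g 0 0 * g 0 1 - g 1 0 * g 1 1) * hypV z) / 2 ∧
    hypV (g • z) = (g 0 0 * g 1 0 + g 0 1 * g 1 1) * hypT z +
      (g 0 0 * g 1 0 - g 0 1 * g 1 1) * hypU z +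
      (g 0 0 * g 1 1 + g 0 1 * g 1 0) * hypV z := by
  have hd := g.det_coe
  rw [Matrix.det_fin_two] at hd
  have hN := denom_sq_pos g z
  have hy := z.im_ne_zero
  have h3 : 1 / (g • z).im = ((g 1 0 * z.re + g 1 1) ^ 2 + (g 1 0 * z.im) ^ 2) / z.im := by
    rw [im_smul_eq, one_div_div]
  have h2 : hypV (g • z) = ((g 0 0 * z.re + g 0 1) * (g 1 0 * z.re + g 1 1) +
      g 0 0 * g 1 0 * z.im ^ 2) / z.im := by
    rw [hypV, im_smul_eq, re_smul_eq, div_div_div_cancel_right₀ hN.ne']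
  have h1 : ((g • z).re ^ 2 + (g • z).im ^ 2) / (g • z).im =
      ((g 0 0 * z.re + g 0 1) ^ 2 + (g 0 0 * z.im) ^ 2) / z.im := by
    rw [im_smul_eq, re_smul_eq]
    generalize g 0 0 = a at *
    generalize g 0 1 = b at *
    generalize g 1 0 = c at *
    generalize g 1 1 = d at *
    generalize z.re = x at *
    generalize z.im = y at *
    -- This is |w|² = |az + b|² |cz + d|² for w = (az + b) times the conjugate of cz + d; the
    -- imaginary part of w is y because the determinant is 1.
    have key : ((a * x + b) * (c * x + d) + a * c * y ^ 2) ^ 2 + y ^ 2 =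
        ((a * x + b) ^ 2 + (a * y) ^ 2) * ((c * x + d) ^ 2 + (c * y) ^ 2) := by
      linear_combination (-y ^ 2) * (a * d - b * c + 1) * hd
    have hN' := hN.ne'
    rw [div_pow, div_pow, ← add_div, key, pow_two ((c * x + d) ^ 2 + (c * y) ^ 2),
      mul_div_mul_right _ _ hN', div_div_div_cancel_right₀ hN']
  have eT : hypT (g • z) =
      (((g • z).re ^ 2 + (g • z).im ^ 2) / (g • z).im + 1 / (g • z).im) / 2 := by
    rw [hypT]; field_simp
  have eU : hypU (g • z) =
      (((g • z).re ^ 2 + (g • z).im ^ 2) / (g • z).im - 1 / (g • z).im) / 2 := by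
    rw [hypU]; field_simp
  rw [eT, eU, h1, h2, h3]
  unfold hypT hypU hypV
  refine ⟨?_, ?_, ?_⟩ <;> · field_simp; ring

/-! ### Translations along geodesics through i -/

/-- The hyperbolic translation by `l` along the geodesic through `I` with direction `(e₁, e₂)`. -/
noncomputable def boost (e₁ e₂ l : ℝ) (he : e₁ ^ 2 + e₂ ^ 2 = 1) : SL(2, ℝ) :=
  ⟨!![Real.cosh (l / 2) + e₁ * Real.sinh (l / 2), e₂ * Real.sinh (l / 2);
      e₂ * Real.sinh (l / 2), Real.cosh (l / 2) - e₁ * Real.sinh (l / 2)], by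
    rw [Matrix.det_fin_two_of]
    linear_combination Real.cosh_sq (l / 2) - Real.sinh (l / 2) ^ 2 * he⟩

lemma hyp_boost_smul (e₁ e₂ l : ℝ) (he : e₁ ^ 2 + e₂ ^ 2 = 1) (z : ℍ) :
    hypT (boost e₁ e₂ l he • z) =
      Real.cosh l * hypT z + Real.sinh l * (e₁ * hypU z + e₂ * hypV z) ∧
    hypU (boost e₁ e₂ l he • z) = hypU z +
      e₁ * (Real.sinh l * hypT z + (Real.cosh l - 1) * (e₁ * hypU z + e₂ * hypV z)) ∧
    hypV (boost e₁ e₂ l he • z) = hypV z +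
      e₂ * (Real.sinh l * hypT z + (Real.cosh l - 1) * (e₁ * hypU z + e₂ * hypV z)) := by
  obtain ⟨h1, h2, h3⟩ := hyp_smul (boost e₁ e₂ l he) z
  have hc : Real.cosh l = 1 + 2 * Real.sinh (l / 2) ^ 2 := by
    have := Real.cosh_two_mul (l / 2)
    rw [Real.cosh_sq, mul_div_cancel₀ _ two_ne_zero] at this
    linarith
  have hs : Real.sinh l = 2 * Real.sinh (l / 2) * Real.cosh (l / 2) := by
    rw [← Real.sinh_two_mul]; ring_nf
  have hcs := Real.cosh_sq (l / 2)
  rw [h1, h2, h3, hc, hs]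
  simp only [boost, Matrix.SpecialLinearGroup.coe_mk, Matrix.of_apply, Matrix.cons_val', Matrix.cons_val_zero,
    Matrix.cons_val_one, Matrix.cons_val_fin_one]
  generalize Real.cosh (l / 2) = C at *
  generalize Real.sinh (l / 2) = S at *
  generalize hypT z = T
  generalize hypU z = U
  generalize hypV z = V
  refine ⟨?_, ?_, ?_⟩
  · linear_combination T * hcs + S ^ 2 * T * he
  · linear_combination U * hcs - S ^ 2 * U * he
  · linear_combination V * hcs - S ^ 2 * V * he

lemma toGL_smul (g : SL(2, ℝ)) (z : ℍ) : (g : GL (Fin 2) ℝ) • z = g • z := by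
  apply UpperHalfPlane.ext
  rw [UpperHalfPlane.coe_specialLinearGroup_apply, UpperHalfPlane.coe_smul_of_det_pos (by simp)]
  rfl

/-- If h⁻¹g fixes a point without being central, it is elliptic and has only that fixed point in ℍ.
-/
lemma smul_eq_smul_of_two_points {g h : SL(2, ℝ)} {z w : ℍ} (hzw : z ≠ w)
    (hz : g • z = h • z) (hw : g • w = h • w) (x : ℍ) : g • x = h • x := by
  have hz' : ((h⁻¹ * g : SL(2, ℝ)) : GL (Fin 2) ℝ) • z = z := by
    rw [toGL_smul, mul_smul, hz, inv_smul_smul]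
  have hw' : ((h⁻¹ * g : SL(2, ℝ)) : GL (Fin 2) ℝ) • w = w := by
    rw [toGL_smul, mul_smul, hw, inv_smul_smul]
  have hpos : 0 < ((h⁻¹ * g : SL(2, ℝ)) : GL (Fin 2) ℝ).val.det := by simp
  have hx : ((h⁻¹ * g : SL(2, ℝ)) : GL (Fin 2) ℝ) • x = x := by
    by_cases hc : ((h⁻¹ * g : SL(2, ℝ)) : GL (Fin 2) ℝ) ∈ Subgroup.center (GL (Fin 2) ℝ)
    · exact UpperHalfPlane.forall_smul_eq_self_iff_mem_center.mpr hc x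
    · have hell := UpperHalfPlane.isElliptic_of_exists_smul_eq_self hpos hc ⟨z, hz'⟩
      rw [UpperHalfPlane.gl_smul_eq_self_iff_eq_fixedPt hpos hell] at hz' hw'
      exact absurd (hz'.trans hw'.symm) hzw
  rw [toGL_smul, mul_smul, inv_smul_eq_iff] at hx
  exact hx

/-- Classification of the geodesic lines through `I`, in the hyperboloid model. -/
lemma exists_hyp_of_isometry {a : ℝ → ℍ} (ha : Isometry a) (h0 : a 0 = UpperHalfPlane.I) :
    ∃ e₁ e₂ : ℝ, e₁ ^ 2 + e₂ ^ 2 = 1 ∧ ∀ r, hypT (a r) = Real.cosh r ∧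
      hypU (a r) = e₁ * Real.sinh r ∧ hypV (a r) = e₂ * Real.sinh r := by
  have hd : ∀ r q, hypT (a r) * hypT (a q) - hypU (a r) * hypU (a q) - hypV (a r) * hypV (a q) =
      Real.cosh (r - q) := fun r q => by
    rw [← cosh_dist_eq_hyp, ha.dist_eq, Real.dist_eq, Real.cosh_abs]
  have hT : ∀ r, hypT (a r) = Real.cosh r := fun r => by
    simpa [h0] using hd r 0
  have hUV : ∀ r q, hypU (a r) * hypU (a q) + hypV (a r) * hypV (a q) =
      Real.sinh r * Real.sinh q := fun r q => by
    have := hd r q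
    rw [hT, hT, Real.cosh_sub] at this
    linarith
  have hs : Real.sinh 1 ≠ 0 := (Real.sinh_pos_iff.mpr one_pos).ne'
  have h11 := hUV 1 1
  refine ⟨hypU (a 1) / Real.sinh 1, hypV (a 1) / Real.sinh 1, ?_, fun r => ⟨hT r, ?_⟩⟩
  · field_simp; linarith
  have hrr := hUV r r
  have hr1 := hUV r 1
  -- The equality case of Cauchy–Schwarz: the space parts of `a r` and `a 1` have lengths |sinh r|
  -- and sinh 1 and inner product sinh r sinh 1, so they are proportional.
  have key : (hypU (a r) - hypU (a 1) / Real.sinh 1 * Real.sinh r) ^ 2 +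
      (hypV (a r) - hypV (a 1) / Real.sinh 1 * Real.sinh r) ^ 2 = 0 := by
    field_simp
    linear_combination Real.sinh 1 ^ 2 * hrr - 2 * Real.sinh 1 * Real.sinh r * hr1
      + Real.sinh r ^ 2 * h11
  constructor <;> nlinarith [key]

/-- At i, `hypV` varies in the horizontal direction and `hypU` in the vertical one, hence the
swapped order e₂ + e₁ i. -/
lemma hasDerivAt_coe_of_hyp {a : ℝ → ℍ} {e₁ e₂ : ℝ}
    (h : ∀ r, hypT (a r) = Real.cosh r ∧
      hypU (a r) = e₁ * Real.sinh r ∧ hypV (a r) = e₂ * Real.sinh r) :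
    HasDerivAt (fun r : ℝ => (a r : ℂ)) (e₂ + e₁ * Complex.I) 0 := by
  have hfun : (fun r : ℝ => (a r : ℂ)) = fun r : ℝ => (((e₂ * Real.sinh r : ℝ) : ℂ) + Complex.I) /
      ((Real.cosh r - e₁ * Real.sinh r : ℝ) : ℂ) := by
    funext r
    obtain ⟨h1, h2, h3⟩ := h r
    rw [coe_eq_hyp, h1, h2, h3]
  rw [hfun]
  have hn : HasDerivAt (fun r : ℝ => ((e₂ * Real.sinh r : ℝ) : ℂ) + Complex.I)
      ((e₂ * Real.cosh 0 : ℝ) : ℂ) 0 :=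
    (((Real.hasDerivAt_sinh 0).const_mul e₂).ofReal_comp).add_const _
  have hd : HasDerivAt (fun r : ℝ => ((Real.cosh r - e₁ * Real.sinh r : ℝ) : ℂ))
      ((Real.sinh 0 - e₁ * Real.cosh 0 : ℝ) : ℂ) 0 :=
    ((Real.hasDerivAt_cosh 0).sub ((Real.hasDerivAt_sinh 0).const_mul e₁)).ofReal_comp
  refine (hn.div hd (by simp)).congr_deriv ?_
  simp [mul_comm]

/-- A translation along a geodesic line through `I` acts as a `boost`. -/
lemma smul_eq_boost_smul {a : ℝ → ℍ} {e₁ e₂ l : ℝ} (he : e₁ ^ 2 + e₂ ^ 2 = 1)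
    (h : ∀ r, hypT (a r) = Real.cosh r ∧
      hypU (a r) = e₁ * Real.sinh r ∧ hypV (a r) = e₂ * Real.sinh r)
    {A : SL(2, ℝ)} (hA : ∀ r, A • a r = a (r + l)) (z : ℍ) :
    A • z = boost e₁ e₂ l he • z := by
  have hb : ∀ r, A • a r = boost e₁ e₂ l he • a r := fun r => by
    rw [hA]
    obtain ⟨b1, b2, b3⟩ := hyp_boost_smul e₁ e₂ l he (a r)
    obtain ⟨h1, h2, h3⟩ := h r
    obtain ⟨k1, k2, k3⟩ := h (r + l)
    rw [h1, h2, h3] at b1 b2 b3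
    apply hyp_ext
    · rw [k1, b1, Real.cosh_add]
      linear_combination (-Real.sinh l * Real.sinh r) * he
    · rw [k2, b2, Real.sinh_add]
      linear_combination (-e₁ * (Real.cosh l - 1) * Real.sinh r) * he
    · rw [k3, b3, Real.sinh_add]
      linear_combination (-e₂ * (Real.cosh l - 1) * Real.sinh r) * he
  refine smul_eq_smul_of_two_points (z := a 0) (w := a 1) (fun h01 => ?_) (hb 0) (hb 1) z
  have := congrArg hypT h01
  rw [(h 0).1, (h 1).1, Real.cosh_zero] at this
  exact (Real.one_lt_cosh.mpr one_ne_zero).ne this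

/-- Any geodesic line through `p` is moved to the standard form by `toSL2R p`. -/
lemma exists_standard_form {a : ℝ → ℍ} (ha : Isometry a) (s : ℝ) {p : ℍ} (hp : a s = p) :
    ∃ e₁ e₂ : ℝ, ∃ he : e₁ ^ 2 + e₂ ^ 2 = 1,
      deriv (fun r : ℝ => (a r : ℂ)) s = (p.im : ℂ) * (e₂ + e₁ * Complex.I) ∧
      ∀ (A : SL(2, ℝ)) (l : ℝ), (∀ r, A • a r = a (r + l)) →
        ∀ z : ℍ, p.toSL2R⁻¹ • A • z = boost e₁ e₂ l he • p.toSL2R⁻¹ • z := by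
  set h := p.toSL2R with hh
  have hI : h⁻¹ • p = UpperHalfPlane.I := by
    rw [inv_smul_eq_iff, hh, UpperHalfPlane.toSL2R_smul_I]
  obtain ⟨e₁, e₂, he, hyp⟩ := exists_hyp_of_isometry (a := fun r => h⁻¹ • a (r + s))
    ((isometry_smul ℍ h⁻¹).comp (ha.comp (isometry_add_right s))) (by simp [hp, hI])
  refine ⟨e₁, e₂, he, ?_, fun A l hA z => ?_⟩
  · have hd := hasDerivAt_coe_of_hyp hyp
    have hd' : HasDerivAt (fun r : ℝ => ((h⁻¹ • a r : ℍ) : ℂ)) (e₂ + e₁ * Complex.I) s := by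
      have := HasDerivAt.comp_sub_const (f := fun r : ℝ => ((h⁻¹ • a (r + s) : ℍ) : ℂ)) s s
        (by simpa using hd)
      simpa using this
    have hsq : ((√p.im : ℝ) : ℂ) * ((√p.im : ℝ) : ℂ) = (p.im : ℂ) := by
      rw [← Complex.ofReal_mul, Real.mul_self_sqrt p.im_pos.le]
    have hne : ((√p.im : ℝ) : ℂ) ≠ 0 := by
      exact_mod_cast (Real.sqrt_pos.mpr p.im_pos).ne'
    -- `toSL2R p` acts as z ↦ (im p) z + re p, so tangent vectors at `p` are those at i times a
    -- positive real, and angles are unchanged.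
    have hfun : (fun r : ℝ => (a r : ℂ)) =
        fun r => (p.im : ℂ) * ((h⁻¹ • a r : ℍ) : ℂ) + p.re := by
      funext r
      have := UpperHalfPlane.coe_specialLinearGroup_apply h (h⁻¹ • a r)
      rw [smul_inv_smul] at this
      rw [this, hh]
      simp [UpperHalfPlane.coe_toSL2R]
      rw [← hsq]
      field_simp
    rw [hfun]
    exact ((hd'.const_mul _).add_const _).deriv
  · have := smul_eq_boost_smul (l := l) he hyp (A := h⁻¹ * A * h) (fun r => by
      simp only [mul_smul, smul_inv_smul, hA]
      rw [add_right_comm]) (h⁻¹ • z)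
    rw [← this]
    simp only [mul_smul, smul_inv_smul]

lemma sin_angle_sq {e₁ e₂ f₁ f₂ c : ℝ} (hc : 0 < c) (he : e₁ ^ 2 + e₂ ^ 2 = 1)
    (hf : f₁ ^ 2 + f₂ ^ 2 = 1) :
    Real.sin (InnerProductGeometry.angle ((c : ℂ) * (e₂ + e₁ * Complex.I))
      ((c : ℂ) * (f₂ + f₁ * Complex.I))) ^ 2 = (e₁ * f₂ - e₂ * f₁) ^ 2 := by
  have h1 : ‖(e₂ + e₁ * Complex.I : ℂ)‖ = 1 := by
    rw [Complex.norm_add_mul_I, add_comm, he, Real.sqrt_one]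
  have h2 : ‖(f₂ + f₁ * Complex.I : ℂ)‖ = 1 := by
    rw [Complex.norm_add_mul_I, add_comm, hf, Real.sqrt_one]
  rw [← Complex.real_smul (x := c), ← Complex.real_smul (x := c),
    InnerProductGeometry.angle_smul_left_of_pos _ _ hc,
    InnerProductGeometry.angle_smul_right_of_pos _ _ hc, Real.sin_sq,
    InnerProductGeometry.cos_angle, h1, h2]
  simp [Complex.inner]
  linear_combination (-1 : ℝ) * (f₁ ^ 2 + f₂ ^ 2) * he - hf

/-! ### Infinite area near ideal points of the Klein disc -/

open MeasureTheory

/-- The extension to `ℂ` of the coordinates of the Klein disc model. -/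
noncomputable def klein (w : ℂ) : ℝ × ℝ :=
  ((Complex.normSq w - 1) / (Complex.normSq w + 1), 2 * w.re / (Complex.normSq w + 1))

lemma continuous_klein : Continuous klein := by
  have h : ∀ w : ℂ, Complex.normSq w + 1 ≠ 0 := fun w => by
    have := Complex.normSq_nonneg w
    positivity
  exact ((Complex.continuous_normSq.sub continuous_const).div
    (Complex.continuous_normSq.add continuous_const) h).prodMk
    ((continuous_const.mul Complex.continuous_re).div
    (Complex.continuous_normSq.add continuous_const) h)

lemma klein_coe (z : ℍ) : klein z = (hypU z / hypT z, hypV z / hypT z) := by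
  have := z.im_pos
  have h1 : z.re ^ 2 + z.im ^ 2 + 1 ≠ 0 := by positivity
  have h2 : z.re * z.re + z.im * z.im + 1 ≠ 0 := by rwa [← pow_two, ← pow_two]
  unfold klein hypU hypV hypT
  rw [Complex.normSq_apply]
  simp only [UpperHalfPlane.coe_re, UpperHalfPlane.coe_im]
  ext
  · simp only; field_simp
  · simp only; field_simp

/-- On the real line `klein` is inverse stereographic projection, which reaches every point of the
unit circle except (1, 0). That point is the image of ∞ and is approached along x = 1/y with y → 0.
-/
lemma exists_real_klein_mem {O : Set (ℝ × ℝ)} (hO : IsOpen O) {u : ℝ × ℝ} (hu : u ∈ O)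
    (hu1 : u.1 ^ 2 + u.2 ^ 2 = 1) : ∃ x : ℝ, klein x ∈ O := by
  by_cases h : u.1 = 1
  · have h2 : u.2 = 0 := by rw [h] at hu1; nlinarith
    have hlim : Filter.Tendsto (fun y : ℝ => klein (y⁻¹ : ℝ)) (nhdsWithin 0 {0}ᶜ) (nhds u) := by
      have hc : Continuous fun y : ℝ => ((1 - y ^ 2) / (1 + y ^ 2), 2 * y / (1 + y ^ 2)) := by
        have : ∀ y : ℝ, 1 + y ^ 2 ≠ 0 := fun y => by positivity
        fun_prop (disch := assumption)
      have h0 := (hc.tendsto 0).mono_left (nhdsWithin_le_nhds (s := {0}ᶜ))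
      have hu' : u = (1, 0) := Prod.ext h h2
      rw [hu']
      simp only [ne_eq, OfNat.ofNat_ne_zero, not_false_eq_true, zero_pow, sub_zero, add_zero,
        div_one, mul_zero] at h0
      refine h0.congr' ?_
      filter_upwards [self_mem_nhdsWithin] with y hy
      have hy : y ≠ 0 := hy
      rw [klein, Complex.normSq_ofReal, Complex.ofReal_re]
      ext
      · simp only; field_simp
      · simp only; field_simp
    obtain ⟨y, hy⟩ := (hlim.eventually (hO.mem_nhds hu)).exists
    exact ⟨_, hy⟩
  · have h1 : 1 - u.1 ≠ 0 := sub_ne_zero.mpr (Ne.symm h)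
    refine ⟨u.2 / (1 - u.1), ?_⟩
    convert hu
    have h2 : u.2 ^ 2 = (1 - u.1) * (1 + u.1) := by linarith
    have h3 : u.2 / (1 - u.1) * (u.2 / (1 - u.1)) = (1 + u.1) / (1 - u.1) := by
      field_simp; linarith
    rw [klein, Complex.normSq_ofReal, Complex.ofReal_re, h3]
    have h4 : (1 + u.1) / (1 - u.1) + 1 = 2 / (1 - u.1) := by field_simp; ring
    rw [h4]
    ext
    · simp only; field_simp; ring
    · simp only; field_simp

lemma volume_reProdIm (s t : Set ℝ) : volume (s ×ℂ t) = volume s * volume t := by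
  have : s ×ℂ t = Complex.measurableEquivRealProd ⁻¹' (s ×ˢ t) := rfl
  rw [this, Complex.volume_preserving_equiv_real_prod.measure_preimage_equiv,
    Measure.volume_eq_prod, Measure.prod_prod]

/-- The slab δ/2 < y < δ of the box has Euclidean area εδ and density at least 1/δ², so its
hyperbolic area is at least ε/δ, which is unbounded as δ → 0. -/
lemma volume_eq_top_of_box_subset {D : Set ℍ} {x ε : ℝ} (hε : 0 < ε)
    (hD : ∀ z : ℍ, |z.re - x| < ε → z.im < ε → z ∈ D) : volume D = ⊤ := by
  by_contra hfin
  have hle : ∀ δ, 0 < δ → δ < ε → ENNReal.ofReal (ε / δ) ≤ volume D := by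
    intro δ hδ hδε
    have hsub : Set.Ioo (x - ε) (x + ε) ×ℂ Set.Ioo (δ / 2) δ ⊆ ((↑) '' D : Set ℂ) := by
      rintro w ⟨h1, h2⟩
      have h1 : w.re ∈ Set.Ioo (x - ε) (x + ε) := h1
      have h2 : w.im ∈ Set.Ioo (δ / 2) δ := h2
      refine ⟨⟨w, by linarith [h2.1]⟩, hD _ ?_ ?_, rfl⟩
      · rw [abs_lt]
        change -ε < w.re - x ∧ w.re - x < ε
        constructor <;> linarith [h1.1, h1.2]
      · exact h2.2.trans hδε
    have hms : MeasurableSet (Set.Ioo (x - ε) (x + ε) ×ℂ Set.Ioo (δ / 2) δ) :=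
      (measurableSet_Ioo.preimage Complex.measurable_re).inter
        (measurableSet_Ioo.preimage Complex.measurable_im)
    rw [UpperHalfPlane.volume_eq_lintegral]
    calc ENNReal.ofReal (ε / δ)
        = ENNReal.ofReal ((1 / δ) ^ 2) *
            volume (Set.Ioo (x - ε) (x + ε) ×ℂ Set.Ioo (δ / 2) δ) := by
          rw [volume_reProdIm, Real.volume_Ioo, Real.volume_Ioo,
            ← ENNReal.ofReal_mul (by linarith), ← ENNReal.ofReal_mul (by positivity)]
          congr 1
          field_simp
          ring
      _ = ∫⁻ _ in Set.Ioo (x - ε) (x + ε) ×ℂ Set.Ioo (δ / 2) δ,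
            ENNReal.ofReal ((1 / δ) ^ 2) := (setLIntegral_const _ _).symm
      _ ≤ ∫⁻ z in Set.Ioo (x - ε) (x + ε) ×ℂ Set.Ioo (δ / 2) δ,
            ↑((1 / ‖z.im‖₊) ^ 2 : NNReal) := by
          refine setLIntegral_mono' hms fun z hz => ?_
          have h2 : z.im ∈ Set.Ioo (δ / 2) δ := hz.2
          have hz0 : 0 < z.im := by linarith [h2.1]
          rw [ENNReal.ofReal, ENNReal.coe_le_coe, Real.toNNReal_le_iff_le_coe]
          push_cast
          rw [Real.norm_of_nonneg hz0.le]
          exact pow_le_pow_left₀ (by positivity) (one_div_le_one_div_of_le hz0 h2.2.le) 2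
      _ ≤ _ := lintegral_mono_set hsub
  set m := (volume D).toReal with hm
  have hm0 : 0 ≤ m := ENNReal.toReal_nonneg
  -- With this δ the lower bound ε/δ is m + 2, more than the supposed area m.
  have := hle (ε / (m + 2)) (by positivity) (div_lt_self hε (by linarith))
  rw [ENNReal.ofReal_le_iff_le_toReal hfin, ← hm, div_div_cancel₀ hε.ne'] at this
  linarith

lemma volume_klein_preimage_eq_top {O : Set (ℝ × ℝ)} (hO : IsOpen O) {u : ℝ × ℝ} (hu : u ∈ O)
    (hu1 : u.1 ^ 2 + u.2 ^ 2 = 1) : volume {z : ℍ | klein z ∈ O} = ⊤ := by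
  obtain ⟨x, hx⟩ := exists_real_klein_mem hO hu hu1
  obtain ⟨ε, hε, hball⟩ := Metric.isOpen_iff.mp (hO.preimage continuous_klein) x hx
  refine volume_eq_top_of_box_subset (x := x) (half_pos hε) fun z h1 h2 => hball ?_
  rw [Metric.mem_ball, Complex.dist_eq]
  have h3 := Complex.norm_le_abs_re_add_abs_im ((z : ℂ) - x)
  have h4 : |((z : ℂ) - x).re| < ε / 2 := by simpa using h1
  have h5 : |((z : ℂ) - x).im| < ε / 2 := by simpa [abs_of_pos z.im_pos] using h2
  linarith

lemma smulInvariantMeasure_SL : SMulInvariantMeasure SL(2, ℝ) ℍ volume where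
  measure_preimage_smul g s hs := by
    have := measure_preimage_smul (volume : Measure ℍ) (g : GL (Fin 2) ℝ) s
    simpa only [toGL_smul] using this

/-- If `Γ` has finite coarea, then no set with an ideal point in its interior injects
into the quotient by `Γ`. -/
lemma exists_ne_one_of_finiteArea {Γ : Subgroup SL(2, ℝ)} [Countable Γ]
    (hF : ∃ D : Set ℍ, IsFundamentalDomain Γ D volume ∧ volume D < ⊤)
    (h : SL(2, ℝ)) {O : Set (ℝ × ℝ)} (hO : IsOpen O) {u : ℝ × ℝ} (hu : u ∈ O)
    (hu1 : u.1 ^ 2 + u.2 ^ 2 = 1) :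
    ∃ g ∈ Γ, g ≠ 1 ∧ ∃ z : ℍ, klein (h • z : ℍ) ∈ O ∧ klein (h • g • z : ℍ) ∈ O := by
  obtain ⟨F, hF, hfin⟩ := hF
  have := smulInvariantMeasure_SL
  have : SMulInvariantMeasure Γ ℍ volume :=
    ⟨fun g s hs => measure_preimage_smul (volume : Measure ℍ) (g : SL(2, ℝ)) s⟩
  have hopen : IsOpen {z : ℍ | klein z ∈ O} :=
    hO.preimage (continuous_klein.comp UpperHalfPlane.continuous_coe)
  have hopen' : IsOpen ((fun z : ℍ => h • z) ⁻¹' {z : ℍ | klein z ∈ O}) :=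
    hopen.preimage (continuous_const_smul h)
  have hvol : volume ((fun z : ℍ => h • z) ⁻¹' {z : ℍ | klein z ∈ O}) = ⊤ := by
    rw [measure_preimage_smul]
    exact volume_klein_preimage_eq_top hO hu hu1
  -- Pigeonhole: a set with more area than a fundamental domain contains two points related by a
  -- nontrivial element.
  obtain ⟨z, hz, w, hw, g, hg, hgz⟩ := hF.exists_ne_one_smul_eq
    hopen'.measurableSet.nullMeasurableSet (hfin.trans_eq hvol.symm)
  refine ⟨g, g.2, fun h1 => hg (Subtype.ext h1), z, hz, ?_⟩
  have : (g : SL(2, ℝ)) • z = w := hgz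
  rw [this]
  exact hw

/-! ### Ping-pong -/

/-- **Ping-pong**: nontrivial elements of the group generated by the `A i` move a point outside
all the table sets `U` into one of them. -/
lemma exists_smul_mem_of_ping_pong {G X ι : Type*} [Group G] [MulAction G X] [DecidableEq ι]
    (A : ι → G) (U : ι × Bool → Set X)
    (hdisj : ∀ x y, x ≠ y → ∀ z ∈ U x, z ∉ U y)
    (hpos : ∀ i, ∀ z, z ∉ U (i, false) → A i • z ∈ U (i, true))
    (hneg : ∀ i, ∀ z, z ∉ U (i, true) → (A i)⁻¹ • z ∈ U (i, false))
    {g : G} (hg : g ∈ Subgroup.closure (Set.range A)) (hg1 : g ≠ 1)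
    {z : X} (hz : ∀ x, z ∉ U x) : ∃ x, g • z ∈ U x := by
  rw [← FreeGroup.range_lift_eq_closure] at hg
  obtain ⟨w, rfl⟩ := hg
  -- A reduced word sends `z` into the set of its leftmost letter. The set reached by the tail is
  -- not that of the inverse of the next letter, as the word is reduced, so the induction continues.
  have key : ∀ (L : List (ι × Bool)) (x : ι × Bool), FreeGroup.IsReduced (x :: L) →
      ((x :: L).map fun y => bif y.2 then A y.1 else (A y.1)⁻¹).prod • z ∈ U x := by
    have step : ∀ (x : ι × Bool) (p : X), p ∉ U (x.1, !x.2) →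
        (bif x.2 then A x.1 else (A x.1)⁻¹) • p ∈ U x := by
      rintro ⟨i, _ | _⟩ p hp
      · exact hneg i p hp
      · exact hpos i p hp
    intro L
    induction L with
    | nil =>
      intro x _
      simpa using step x z (hz _)
    | cons y L ih =>
      intro x hx
      rw [FreeGroup.isReduced_cons_cons] at hx
      rw [List.map_cons, List.prod_cons, mul_smul]
      refine step x _ (hdisj y _ ?_ _ (ih y hx.2))
      rintro rfl
      simpa using hx.1 rfl
  have hw : (FreeGroup.lift A) w =
      (w.toWord.map fun y => bif y.2 then A y.1 else (A y.1)⁻¹).prod := by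
    conv_lhs => rw [← FreeGroup.mk_toWord (x := w)]
    exact FreeGroup.lift_mk
  have hred : FreeGroup.IsReduced w.toWord := FreeGroup.isReduced_toWord
  rw [hw] at hg1 ⊢
  cases hL : w.toWord with
  | nil => simp [hL] at hg1
  | cons x L => exact ⟨x, key L x (hL ▸ hred)⟩

lemma countable_closure_pair {G : Type*} [Group G] (A B : G) :
    Countable (Subgroup.closure {A, B} : Subgroup G) := by
  rw [FreeGroup.closure_eq_range]
  have : Countable (FreeGroup ({A, B} : Set G)) := Quot.mk_surjective.countable
  exact (Set.countable_range (FreeGroup.lift ((↑) : ({A, B} : Set G) → G))).to_subtype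

/-! ### Choice of the sides of the ping-pong region -/

/-- The quadratic form `n ↦ (a · n)² + (b · n^⊥)²` exceeds `1` at some unit vector. -/
lemma exists_unit_one_lt {a₁ a₂ b₁ b₂ : ℝ}
    (h : (1 - (a₁ ^ 2 + a₂ ^ 2)) * (1 - (b₁ ^ 2 + b₂ ^ 2)) < (a₁ * b₂ - a₂ * b₁) ^ 2) :
    ∃ n₁ n₂ : ℝ, n₁ ^ 2 + n₂ ^ 2 = 1 ∧
      1 < (a₁ * n₁ + a₂ * n₂) ^ 2 + (b₂ * n₁ - b₁ * n₂) ^ 2 := by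
  obtain ⟨x, y, hxy⟩ : ∃ x y : ℝ,
      x ^ 2 + y ^ 2 < (a₁ * x + a₂ * y) ^ 2 + (b₂ * x - b₁ * y) ^ 2 := by
    by_contra! hcon
    -- If Q is the matrix of the form, Lagrange's identity gives det (Q - 1) = (1 - |a|²)(1 - |b|²)
    -- - (a × b)². The hypothesis makes this negative, so Q - 1 is indefinite.
    have hd := discrim_le_zero_of_nonpos (a := a₁ ^ 2 + b₂ ^ 2 - 1)
      (b := 2 * (a₁ * a₂ - b₁ * b₂)) (c := a₂ ^ 2 + b₁ ^ 2 - 1)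
      (fun x => by linarith [hcon x 1])
    rw [discrim] at hd
    linarith
  have hr : 0 < x ^ 2 + y ^ 2 := by
    by_contra! hle
    have hx : x = 0 := by nlinarith [sq_nonneg x, sq_nonneg y]
    have hy : y = 0 := by nlinarith [sq_nonneg x, sq_nonneg y]
    simp [hx, hy] at hxy
  set r := √(x ^ 2 + y ^ 2) with hrdef
  have hr0 : 0 < r := Real.sqrt_pos.mpr hr
  have hr2 : r ^ 2 = x ^ 2 + y ^ 2 := Real.sq_sqrt hr.le
  refine ⟨x / r, y / r, ?_, ?_⟩
  · field_simp; linarith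
  · have : (a₁ * (x / r) + a₂ * (y / r)) ^ 2 + (b₂ * (x / r) - b₁ * (y / r)) ^ 2 =
        ((a₁ * x + a₂ * y) ^ 2 + (b₂ * x - b₁ * y) ^ 2) / r ^ 2 := by field_simp
    rw [this, lt_div_iff₀ (by positivity), one_mul, hr2]
    exact hxy

/-- Two chords of the disc with perpendicular directions `n`, `m` through `a` and `b` which do not
meet inside the closed disc. -/
lemma exists_orthonormal_one_lt {a₁ a₂ b₁ b₂ : ℝ} (ha : a₁ ^ 2 + a₂ ^ 2 < 1)
    (hb : b₁ ^ 2 + b₂ ^ 2 < 1)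
    (h : (1 - (a₁ ^ 2 + a₂ ^ 2)) * (1 - (b₁ ^ 2 + b₂ ^ 2)) < (a₁ * b₂ - a₂ * b₁) ^ 2) :
    ∃ n₁ n₂ m₁ m₂ : ℝ, n₁ ^ 2 + n₂ ^ 2 = 1 ∧ m₁ ^ 2 + m₂ ^ 2 = 1 ∧ n₁ * m₁ + n₂ * m₂ = 0 ∧
      (∀ x y : ℝ, (x * n₁ + y * n₂) ^ 2 + (x * m₁ + y * m₂) ^ 2 = x ^ 2 + y ^ 2) ∧
      0 < a₁ * n₁ + a₂ * n₂ ∧ 0 < b₁ * m₁ + b₂ * m₂ ∧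
      1 < (a₁ * n₁ + a₂ * n₂) ^ 2 + (b₁ * m₁ + b₂ * m₂) ^ 2 := by
  obtain ⟨n₁, n₂, hn, hlt⟩ := exists_unit_one_lt h
  have hCS : ∀ x y : ℝ, (x * n₁ + y * n₂) ^ 2 + (y * n₁ - x * n₂) ^ 2 = x ^ 2 + y ^ 2 :=
    fun x y => by linear_combination (x ^ 2 + y ^ 2) * hn
  have hc : a₁ * n₁ + a₂ * n₂ ≠ 0 := by
    intro h0
    have := hCS b₁ b₂
    rw [h0] at hlt
    nlinarith [sq_nonneg (b₁ * n₁ + b₂ * n₂)]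
  have hd : b₂ * n₁ - b₁ * n₂ ≠ 0 := by
    intro h0
    have := hCS a₁ a₂
    rw [h0] at hlt
    nlinarith [sq_nonneg (a₂ * n₁ - a₁ * n₂)]
  obtain ⟨σ, hσ, hσc⟩ : ∃ σ : ℝ, σ ^ 2 = 1 ∧ 0 < σ * (a₁ * n₁ + a₂ * n₂) := by
    rcases hc.lt_or_gt with h | h
    · exact ⟨-1, by norm_num, by linarith⟩
    · exact ⟨1, by norm_num, by linarith⟩
  obtain ⟨τ, hτ, hτd⟩ : ∃ τ : ℝ, τ ^ 2 = 1 ∧ 0 < τ * (b₂ * n₁ - b₁ * n₂) := by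
    rcases hd.lt_or_gt with h | h
    · exact ⟨-1, by norm_num, by linarith⟩
    · exact ⟨1, by norm_num, by linarith⟩
  refine ⟨σ * n₁, σ * n₂, -(τ * n₂), τ * n₁, ?_, ?_, by ring, fun x y => ?_, by linarith,
    by linarith, ?_⟩
  · linear_combination (n₁ ^ 2 + n₂ ^ 2) * hσ + hn
  · linear_combination (n₁ ^ 2 + n₂ ^ 2) * hτ + hn
  · linear_combination hCS x y + (x * n₁ + y * n₂) ^ 2 * hσ + (y * n₁ - x * n₂) ^ 2 * hτ
  · linear_combination hlt - (a₁ * n₁ + a₂ * n₂) ^ 2 * hσ - (b₂ * n₁ - b₁ * n₂) ^ 2 * hτ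

/-- A `boost` maps the side through the midpoint behind `I` to the parallel side in front. -/
lemma boost_side (e₁ e₂ l : ℝ) (he : e₁ ^ 2 + e₂ ^ 2 = 1) (n₁ n₂ : ℝ) (z : ℍ) :
    hypU (boost e₁ e₂ l he • z) * n₁ + hypV (boost e₁ e₂ l he • z) * n₂ -
      Real.tanh (l / 2) * (e₁ * n₁ + e₂ * n₂) * hypT (boost e₁ e₂ l he • z) =
    hypU z * n₁ + hypV z * n₂ + Real.tanh (l / 2) * (e₁ * n₁ + e₂ * n₂) * hypT z := by
  obtain ⟨h1, h2, h3⟩ := hyp_boost_smul e₁ e₂ l he z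
  have hC := (Real.cosh_pos (l / 2)).ne'
  have hcosh : Real.cosh l = 1 + 2 * Real.sinh (l / 2) ^ 2 := by
    have := Real.cosh_two_mul (l / 2)
    rw [Real.cosh_sq, mul_div_cancel₀ _ two_ne_zero] at this
    linarith
  have hsinh : Real.sinh l = 2 * Real.sinh (l / 2) * Real.cosh (l / 2) := by
    rw [← Real.sinh_two_mul]; ring_nf
  have hcs := Real.cosh_sq (l / 2)
  have k1 : Real.cosh l - 1 = Real.tanh (l / 2) * Real.sinh l := by
    rw [hcosh, hsinh, Real.tanh_eq_sinh_div_cosh]; field_simp; ring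
  have k2 : Real.sinh l = Real.tanh (l / 2) * (Real.cosh l + 1) := by
    rw [hcosh, hsinh, Real.tanh_eq_sinh_div_cosh]; field_simp
    linear_combination 2 * Real.sinh (l / 2) * hcs
  rw [h1, h2, h3]
  linear_combination (e₁ * n₁ + e₂ * n₂) * hypT z * k2 +
    (e₁ * n₁ + e₂ * n₂) * (e₁ * hypU z + e₂ * hypV z) * k1

/-! ### S ≤ 1: otherwise ping-pong leaves an ideal arc free -/

section Generators

variable {Γ : Subgroup SL(2, ℝ)} {A B h : SL(2, ℝ)} {e₁ e₂ f₁ f₂ la lb : ℝ}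
  {he : e₁ ^ 2 + e₂ ^ 2 = 1} {hf : f₁ ^ 2 + f₂ ^ 2 = 1}

/-- If the commutator of the generators is hyperbolic, then the coarea is infinite. -/
lemma sinh_mul_sinh_sq_le_one (hgen : Subgroup.closure {A, B} = Γ)
    (hF : ∃ D : Set ℍ, IsFundamentalDomain Γ D volume ∧ volume D < ⊤)
    (hA : ∀ z : ℍ, h • A • z = boost e₁ e₂ la he • h • z)
    (hB : ∀ z : ℍ, h • B • z = boost f₁ f₂ lb hf • h • z) :
    (Real.sinh (la / 2) * Real.sinh (lb / 2)) ^ 2 * (e₁ * f₂ - e₂ * f₁) ^ 2 ≤ 1 := by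
  by_contra! hlt
  have : Countable Γ := hgen ▸ countable_closure_pair A B
  have htanh : ∀ x : ℝ, 1 - Real.tanh x ^ 2 = 1 / Real.cosh x ^ 2 := fun x => by
    have := (Real.cosh_pos x).ne'
    rw [Real.tanh_eq_sinh_div_cosh]
    field_simp
    linarith [Real.cosh_sq x]
  set τ := Real.tanh (la / 2) with hτ
  set υ := Real.tanh (lb / 2) with hυ
  have e1 : (τ * e₁) ^ 2 + (τ * e₂) ^ 2 = τ ^ 2 := by linear_combination τ ^ 2 * he
  have e2 : (υ * f₁) ^ 2 + (υ * f₂) ^ 2 = υ ^ 2 := by linear_combination υ ^ 2 * hf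
  have hCa := Real.cosh_pos (la / 2)
  have hCb := Real.cosh_pos (lb / 2)
  -- In the Klein disc, τe and υf are the midpoints of the segments from the origin to its images
  -- under the two translations. The chords through ±τe with normal n and through ±υf with normal m
  -- bound a rectangle with half-sides c and d. As 1 - tanh² = 1/cosh², S > 1 is exactly the
  -- condition that allows c² + d² > 1, that is, corners outside the closed disc.
  obtain ⟨n₁, n₂, m₁, m₂, hn, hm, hnm, hpars, hc, hd, hcd⟩ :=
    exists_orthonormal_one_lt (a₁ := τ * e₁) (a₂ := τ * e₂) (b₁ := υ * f₁) (b₂ := υ * f₂)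
      (by rw [e1]; have := htanh (la / 2); have : 0 < 1 / Real.cosh (la / 2) ^ 2 := by positivity
          linarith)
      (by rw [e2]; have := htanh (lb / 2); have : 0 < 1 / Real.cosh (lb / 2) ^ 2 := by positivity
          linarith)
      (by
        rw [e1, e2, htanh, htanh, hτ, hυ, Real.tanh_eq_sinh_div_cosh, Real.tanh_eq_sinh_div_cosh]
        have : (Real.sinh (la / 2) / Real.cosh (la / 2) * e₁ *
            (Real.sinh (lb / 2) / Real.cosh (lb / 2) * f₂) -
            Real.sinh (la / 2) / Real.cosh (la / 2) * e₂ *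
            (Real.sinh (lb / 2) / Real.cosh (lb / 2) * f₁)) ^ 2 =
            ((Real.sinh (la / 2) * Real.sinh (lb / 2)) ^ 2 * (e₁ * f₂ - e₂ * f₁) ^ 2) *
            (1 / Real.cosh (la / 2) ^ 2 * (1 / Real.cosh (lb / 2) ^ 2)) := by
          field_simp
        rw [this]
        exact lt_mul_of_one_lt_left (by positivity) hlt)
  set c := τ * e₁ * n₁ + τ * e₂ * n₂ with hcdef
  set d := υ * f₁ * m₁ + υ * f₂ * m₂ with hddef
  have sideA : ∀ z : ℍ, hypU (h • A • z) * n₁ + hypV (h • A • z) * n₂ - c * hypT (h • A • z) =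
      hypU (h • z) * n₁ + hypV (h • z) * n₂ + c * hypT (h • z) := fun z => by
    have := boost_side e₁ e₂ la he n₁ n₂ (h • z)
    rw [← hA] at this
    linear_combination this
  have sideB : ∀ z : ℍ, hypU (h • B • z) * m₁ + hypV (h • B • z) * m₂ - d * hypT (h • B • z) =
      hypU (h • z) * m₁ + hypV (h • z) * m₂ + d * hypT (h • z) := fun z => by
    have := boost_side f₁ f₂ lb hf m₁ m₂ (h • z)
    rw [← hB] at this
    linear_combination this
  let p : Bool → ℍ → ℝ := fun i z => bif i then hypU (h • z) * n₁ + hypV (h • z) * n₂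
    else hypU (h • z) * m₁ + hypV (h • z) * m₂
  let k : Bool → ℝ := fun i => bif i then c else d
  let U : Bool × Bool → Set ℍ := fun x => {z | k x.1 * hypT (h • z) ≤
    (bif x.2 then 1 else -1) * p x.1 z}
  have hk : ∀ i, 0 < k i := by rintro (_ | _) <;> assumption
  have hside : ∀ i z, p i ((bif i then A else B) • z) - k i * hypT (h • (bif i then A else B) • z) =
      p i z + k i * hypT (h • z) := by
    rintro (_ | _) z
    · exact sideB z
    · exact sideA z
  have hperp : ∀ z : ℍ, p true z ^ 2 + p false z ^ 2 < hypT (h • z) ^ 2 := fun z => by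
    have h1 := hpars (hypU (h • z)) (hypV (h • z))
    have h2 := hypT_sq (h • z)
    change (hypU (h • z) * n₁ + hypV (h • z) * n₂) ^ 2 +
      (hypU (h • z) * m₁ + hypV (h • z) * m₂) ^ 2 < _
    linarith
  have hdisj : ∀ x y, x ≠ y → ∀ z ∈ U x, z ∉ U y := by
    have hsq : ∀ i s z, z ∈ U (i, s) → (k i * hypT (h • z)) ^ 2 ≤ p i z ^ 2 := by
      intro i s z hz
      have h0 : 0 < k i * hypT (h • z) := mul_pos (hk i) (hypT_pos _)
      have hz : k i * hypT (h • z) ≤ (bif s then 1 else -1) * p i z := hz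
      have := pow_le_pow_left₀ h0.le hz 2
      cases s <;> simpa using this
    -- A common point would satisfy (c² + d²)T² ≤ p² + p'² < T², where p and p' are its components
    -- along n and m.
    have hcross : ∀ s t z, z ∈ U (true, s) → z ∉ U (false, t) := by
      intro s t z h1 h2
      have h1 := hsq _ _ _ h1
      have h2 := hsq _ _ _ h2
      have h3 := hperp z
      have h4 : hypT (h • z) ^ 2 < (c ^ 2 + d ^ 2) * hypT (h • z) ^ 2 :=
        lt_mul_of_one_lt_left (pow_pos (hypT_pos _) 2) hcd
      have h1 : (c * hypT (h • z)) ^ 2 ≤ p true z ^ 2 := h1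
      have h2 : (d * hypT (h • z)) ^ 2 ≤ p false z ^ 2 := h2
      linarith
    have hopp : ∀ i z, z ∈ U (i, true) → z ∉ U (i, false) := by
      intro i z h1 h2
      have h0 : 0 < k i * hypT (h • z) := mul_pos (hk i) (hypT_pos _)
      have h1 : k i * hypT (h • z) ≤ 1 * p i z := h1
      have h2 : k i * hypT (h • z) ≤ -1 * p i z := h2
      linarith
    rintro ⟨_ | _, s⟩ ⟨_ | _, t⟩ hne z hz hz'
    · cases s <;> cases t
      · exact hne rfl
      · exact hopp _ _ hz' hz
      · exact hopp _ _ hz hz'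
      · exact hne rfl
    · exact hcross _ _ _ hz' hz
    · exact hcross _ _ _ hz hz'
    · cases s <;> cases t
      · exact hne rfl
      · exact hopp _ _ hz' hz
      · exact hopp _ _ hz hz'
      · exact hne rfl
  have hpos : ∀ i, ∀ z, z ∉ U (i, false) → (bif i then A else B) • z ∈ U (i, true) := by
    intro i z hz
    have hz : ¬ k i * hypT (h • z) ≤ -1 * p i z := hz
    have := hside i z
    change k i * hypT _ ≤ 1 * p i _
    linarith
  have hneg : ∀ i, ∀ z, z ∉ U (i, true) → (bif i then A else B)⁻¹ • z ∈ U (i, false) := by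
    intro i z hz
    have hz : ¬ k i * hypT (h • z) ≤ 1 * p i z := hz
    have := hside i ((bif i then A else B)⁻¹ • z)
    rw [smul_inv_smul] at this
    change k i * hypT _ ≤ -1 * p i _
    linarith
  set r := √(c ^ 2 + d ^ 2) with hr
  have hr1 : 1 < r := by rw [hr, Real.lt_sqrt zero_le_one, one_pow]; exact hcd
  have hr2 : r ^ 2 = c ^ 2 + d ^ 2 := Real.sq_sqrt (by positivity)
  have hr0 : 0 < r := by linarith
  -- The open set is the interior of the rectangle. The ideal point `u` lies in the direction of a
  -- corner, which is at distance r > 1 from the centre, so `u` is inside the rectangle.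
  obtain ⟨g, hg, hg1, z, hz, hgz⟩ := exists_ne_one_of_finiteArea hF h
    (O := {q : ℝ × ℝ | |q.1 * n₁ + q.2 * n₂| < c ∧ |q.1 * m₁ + q.2 * m₂| < d})
    (by refine IsOpen.and (isOpen_lt ?_ ?_) (isOpen_lt ?_ ?_) <;> fun_prop)
    (u := ((c * n₁ + d * m₁) / r, (c * n₂ + d * m₂) / r))
    (by
      have h1 : (c * n₁ + d * m₁) / r * n₁ + (c * n₂ + d * m₂) / r * n₂ = c / r := by
        field_simp; linear_combination c * hn + d * hnm
      have h2 : (c * n₁ + d * m₁) / r * m₁ + (c * n₂ + d * m₂) / r * m₂ = d / r := by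
        field_simp; linear_combination d * hm + c * hnm
      simp only [Set.mem_ofPred_eq, h1, h2]
      rw [abs_of_pos (by positivity), abs_of_pos (by positivity)]
      exact ⟨div_lt_self hc hr1, div_lt_self hd hr1⟩)
    (by
      simp only
      field_simp
      rw [hr2]
      linear_combination c ^ 2 * hn + d ^ 2 * hm + 2 * c * d * hnm)
  have hout : ∀ z : ℍ, klein (h • z : ℍ) ∈ {q : ℝ × ℝ | |q.1 * n₁ + q.2 * n₂| < c ∧
      |q.1 * m₁ + q.2 * m₂| < d} → ∀ x, z ∉ U x := by
    intro z hz
    have hT := hypT_pos (h • z)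
    rw [klein_coe] at hz
    have h1 : ∀ i, |p i z| < k i * hypT (h • z) := by
      rintro (_ | _)
      · have := hz.2
        simp only [div_mul_eq_mul_div, ← add_div] at this
        rw [abs_div, abs_of_pos hT, div_lt_iff₀ hT] at this
        exact this
      · have := hz.1
        simp only [div_mul_eq_mul_div, ← add_div] at this
        rw [abs_div, abs_of_pos hT, div_lt_iff₀ hT] at this
        exact this
    rintro ⟨i, _ | _⟩ hmem
    · have hmem : k i * hypT (h • z) ≤ -1 * p i z := hmem
      linarith [(abs_lt.mp (h1 i)).1]
    · have hmem : k i * hypT (h • z) ≤ 1 * p i z := hmem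
      linarith [(abs_lt.mp (h1 i)).2]
  have hrange : Set.range (fun i : Bool => bif i then A else B) = {A, B} := by
    ext x; simp [eq_comm, or_comm]
  obtain ⟨x, hx⟩ := exists_smul_mem_of_ping_pong (fun i : Bool => bif i then A else B) U
    hdisj hpos hneg (g := g) (by rw [hrange, hgen]; exact hg) hg1 (hout z hz)
  exact hout _ hgz x hx

end Generators

/-! ### S ≥ 1 unless S = 0: the commutator is not elliptic -/

lemma trace_commutator_boost (e₁ e₂ f₁ f₂ la lb : ℝ) (he : e₁ ^ 2 + e₂ ^ 2 = 1)
    (hf : f₁ ^ 2 + f₂ ^ 2 = 1) :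
    (boost e₁ e₂ la he * boost f₁ f₂ lb hf * (boost e₁ e₂ la he)⁻¹ *
      (boost f₁ f₂ lb hf)⁻¹).val.trace =
    2 - 4 * ((Real.sinh (la / 2) * Real.sinh (lb / 2)) ^ 2 * (e₁ * f₂ - e₂ * f₁) ^ 2) := by
  have h1 := (boost e₁ e₂ la he).det_coe
  have h2 := (boost f₁ f₂ lb hf).det_coe
  simp only [Matrix.SpecialLinearGroup.coe_mul, Matrix.SpecialLinearGroup.coe_inv]
  simp only [boost, Matrix.SpecialLinearGroup.coe_mk, Matrix.det_fin_two_of,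
    Matrix.adjugate_fin_two_of] at h1 h2 ⊢
  generalize Real.cosh (la / 2) = C at *
  generalize Real.sinh (la / 2) = S at *
  generalize Real.cosh (lb / 2) = C' at *
  generalize Real.sinh (lb / 2) = S' at *
  simp only [Matrix.mul_fin_two, Matrix.trace_fin_two_of]
  linear_combination 2 * ((C' + f₁ * S') * (C' - f₁ * S') - f₂ * S' * (f₂ * S')) * h1 + 2 * h2

section Generators

variable {Γ : Subgroup SL(2, ℝ)} {A B h : SL(2, ℝ)} {e₁ e₂ f₁ f₂ la lb : ℝ}
  {he : e₁ ^ 2 + e₂ ^ 2 = 1} {hf : f₁ ^ 2 + f₂ ^ 2 = 1}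

/-- If the generators do not commute, then their commutator is not elliptic. -/
lemma one_le_sinh_mul_sinh_sq (hAΓ : A ∈ Γ) (hBΓ : B ∈ Γ)
    (hfree : ∀ g ∈ Γ, ∀ z : ℍ, g • z = z → g = 1)
    (hA : ∀ z : ℍ, h • A • z = boost e₁ e₂ la he • h • z)
    (hB : ∀ z : ℍ, h • B • z = boost f₁ f₂ lb hf • h • z)
    (h0 : 0 < (Real.sinh (la / 2) * Real.sinh (lb / 2)) ^ 2 * (e₁ * f₂ - e₂ * f₁) ^ 2) :
    1 ≤ (Real.sinh (la / 2) * Real.sinh (lb / 2)) ^ 2 * (e₁ * f₂ - e₂ * f₁) ^ 2 := by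
  by_contra! hlt
  have htr := trace_commutator_boost e₁ e₂ f₁ f₂ la lb he hf
  set M := boost e₁ e₂ la he
  set N := boost f₁ f₂ lb hf
  set k := M * N * M⁻¹ * N⁻¹ with hk
  have hinv : ∀ {A M : SL(2, ℝ)}, (∀ z : ℍ, h • A • z = M • h • z) →
      ∀ z : ℍ, h • A⁻¹ • z = M⁻¹ • h • z := fun {A M} hA z => by
    rw [eq_inv_smul_iff, ← hA, smul_inv_smul]
  have hcomm : ∀ z : ℍ, h • (A * B * A⁻¹ * B⁻¹) • z = k • h • z := fun z => by
    simp only [hk, mul_smul]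
    rw [hA, hB, hinv hA, hinv hB]
  -- For 0 < S < 1 the trace 2 - 4S lies strictly between -2 and 2.
  have hell : (k : GL (Fin 2) ℝ).IsElliptic := by
    change Matrix.discr _ < 0
    rw [Matrix.discr_fin_two]
    change k.val.trace ^ 2 - 4 * k.val.det < 0
    rw [htr, k.det_coe]
    nlinarith
  have hpos : 0 < (k : GL (Fin 2) ℝ).val.det := by simp
  have hfix : ∀ z : ℍ, k • z = z ↔ z = UpperHalfPlane.fixedPt k hell := fun z => by
    rw [← toGL_smul]
    exact UpperHalfPlane.gl_smul_eq_self_iff_eq_fixedPt hpos hell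
  set z₀ := UpperHalfPlane.fixedPt k hell
  have h1 : A * B * A⁻¹ * B⁻¹ = 1 := by
    refine hfree _ (Γ.mul_mem (Γ.mul_mem (Γ.mul_mem hAΓ hBΓ) (Γ.inv_mem hAΓ)) (Γ.inv_mem hBΓ))
      (h⁻¹ • z₀) ?_
    rw [eq_inv_smul_iff, hcomm, smul_inv_smul]
    exact (hfix z₀).mpr rfl
  -- Freeness made the commutator in Γ trivial, so `k` fixes every point, although an elliptic
  -- element fixes only one.
  obtain ⟨z, hz⟩ := exists_ne z₀
  refine hz ((hfix z).mp ?_)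
  have := hcomm (h⁻¹ • z)
  rw [h1, one_smul, smul_inv_smul] at this
  exact this.symm

/-! ### S ≠ 0: the two axes are distinct -/

/-- The generators do not translate along the same geodesic, because otherwise the coarea would be
infinite. -/
lemma cross_ne_zero (hgen : Subgroup.closure {A, B} = Γ)
    (hfree : ∀ g ∈ Γ, ∀ z : ℍ, g • z = z → g = 1) (hpd : ProperlyDiscontinuousSMul Γ ℍ)
    (hF : ∃ D : Set ℍ, IsFundamentalDomain Γ D volume ∧ volume D < ⊤)
    (hA : ∀ z : ℍ, h • A • z = boost e₁ e₂ la he • h • z)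
    (hB : ∀ z : ℍ, h • B • z = boost f₁ f₂ lb hf • h • z) :
    e₁ * f₂ - e₂ * f₁ ≠ 0 := by
  intro hcross
  have : Countable Γ := hgen ▸ countable_closure_pair A B
  let K : ℍ → ℝ := fun z => e₁ * hypU z + e₂ * hypV z
  -- The null coordinates T ± K along the common axis are eigenvectors of every translation along
  -- it, with factors exp (±r). The property passes to products and inverses.
  have htrans : ∀ g ∈ Γ, ∃ r : ℝ, ∀ z : ℍ,
      hypT (h • g • z) + K (h • g • z) = Real.exp r * (hypT (h • z) + K (h • z)) ∧
      hypT (h • g • z) - K (h • g • z) = Real.exp (-r) * (hypT (h • z) - K (h • z)) := by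
    intro g hg
    rw [← hgen] at hg
    induction hg using Subgroup.closure_induction with
    | mem x hx =>
      rcases hx with rfl | hx
      · refine ⟨la, fun z => ?_⟩
        obtain ⟨h1, h2, h3⟩ := hyp_boost_smul e₁ e₂ la he (h • z)
        simp only [K, hA, h1, h2, h3]
        rw [← Real.cosh_add_sinh, ← Real.cosh_sub_sinh]
        constructor
        · linear_combination (Real.sinh la * hypT (h • z) +
            (Real.cosh la - 1) * (e₁ * hypU (h • z) + e₂ * hypV (h • z))) * he
        · linear_combination (-(Real.sinh la * hypT (h • z) +
            (Real.cosh la - 1) * (e₁ * hypU (h • z) + e₂ * hypV (h • z)))) * he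
      · obtain rfl : x = B := hx
        set σ := e₁ * f₁ + e₂ * f₂ with hσ
        -- Parallel unit vectors agree up to the sign σ, so `B` translates by σ·lb in the direction
        -- e.
        have hf1 : f₁ = σ * e₁ := by linear_combination (-f₁) * he - e₂ * hcross
        have hf2 : f₂ = σ * e₂ := by linear_combination (-f₂) * he + e₁ * hcross
        have hσ2 : σ ^ 2 = 1 := by
          rw [hσ]
          linear_combination (f₁ ^ 2 + f₂ ^ 2) * he + hf - (e₁ * f₂ - e₂ * f₁) * hcross
        have hes : Real.cosh (σ * lb) = Real.cosh lb ∧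
            Real.sinh (σ * lb) = σ * Real.sinh lb := by
          rcases mul_eq_zero.mp (show (σ - 1) * (σ + 1) = 0 by linear_combination hσ2) with h | h
          · simp [sub_eq_zero.mp h]
          · simp [eq_neg_of_add_eq_zero_left h]
        clear_value σ
        refine ⟨σ * lb, fun z => ?_⟩
        obtain ⟨h1, h2, h3⟩ := hyp_boost_smul f₁ f₂ lb hf (h • z)
        simp only [K, hB, h1, h2, h3]
        rw [← Real.cosh_add_sinh, ← Real.cosh_sub_sinh, hes.1, hes.2, hf1, hf2]
        constructor
        · linear_combination σ * (Real.sinh lb * hypT (h • z) +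
            (Real.cosh lb - 1) * σ * (e₁ * hypU (h • z) + e₂ * hypV (h • z))) * he +
            (Real.cosh lb - 1) * (e₁ * hypU (h • z) + e₂ * hypV (h • z)) * hσ2
        · linear_combination (-σ) * (Real.sinh lb * hypT (h • z) +
            (Real.cosh lb - 1) * σ * (e₁ * hypU (h • z) + e₂ * hypV (h • z))) * he -
            (Real.cosh lb - 1) * (e₁ * hypU (h • z) + e₂ * hypV (h • z)) * hσ2
    | one => exact ⟨0, fun z => by simp⟩
    | mul x y _ _ hx hy =>
      obtain ⟨r, hr⟩ := hx
      obtain ⟨q, hq⟩ := hy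
      refine ⟨r + q, fun z => ?_⟩
      rw [mul_smul, (hr _).1, (hr _).2, (hq _).1, (hq _).2, neg_add, Real.exp_add, Real.exp_add]
      constructor <;> ring
    | inv x _ hx =>
      obtain ⟨r, hr⟩ := hx
      refine ⟨-r, fun z => ?_⟩
      obtain ⟨h1, h2⟩ := hr (x⁻¹ • z)
      rw [smul_inv_smul] at h1 h2
      rw [h1, h2, ← mul_assoc, ← mul_assoc, ← Real.exp_add, ← Real.exp_add]
      simp
  set p : ℍ := h⁻¹ • UpperHalfPlane.I with hp
  have hhp : h • p = UpperHalfPlane.I := by rw [hp, smul_inv_smul]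
  -- Only finitely many elements move `p` by at most 1, and by freeness none but the identity fixes
  -- it.
  obtain ⟨ε, hε, hmin⟩ : ∃ ε > 0, ∀ g ∈ Γ, g ≠ 1 → ε ≤ dist (g • p) p := by
    have hfin := hpd.finite_disjoint_inter_image (isCompact_singleton (x := p))
      (ProperSpace.isCompact_closedBall p 1)
    have hfin' := (hfin.subset (t := {g : Γ | g ≠ 1 ∧ dist (g • p) p ≤ 1})
      (fun g hg => ⟨g • p, ⟨p, rfl, rfl⟩, hg.2⟩)).image (fun g : Γ => dist (g • p) p)
    have hcl := hfin'.isClosed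
    have h0 : (0 : ℝ) ∉ (fun g : Γ => dist (g • p) p) ''
        {g : Γ | g ≠ 1 ∧ dist (g • p) p ≤ 1} := by
      rintro ⟨g, hg, hg0⟩
      exact hg.1 (Subtype.ext (hfree g g.2 p (dist_eq_zero.mp hg0)))
    obtain ⟨ε, hε, hball⟩ := Metric.isOpen_iff.mp hcl.isOpen_compl 0 h0
    refine ⟨min ε 1, by positivity, fun g hg hg1 => ?_⟩
    by_contra! hlt
    refine hball (a := dist (g • p) p) ?_ ⟨⟨g, hg⟩, ⟨fun h => hg1 (congrArg Subtype.val h),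
      (hlt.trans_le (min_le_right _ _)).le⟩, rfl⟩
    rw [Metric.mem_ball, Real.dist_eq, sub_zero, abs_of_nonneg dist_nonneg]
    exact hlt.trans_le (min_le_left _ _)
  have hlong : ∀ g ∈ Γ, g ≠ 1 → ∀ r : ℝ, (∀ z : ℍ,
      hypT (h • g • z) + K (h • g • z) = Real.exp r * (hypT (h • z) + K (h • z)) ∧
      hypT (h • g • z) - K (h • g • z) = Real.exp (-r) * (hypT (h • z) - K (h • z))) →
      ε ≤ |r| := by
    intro g hg hg1 r hr
    obtain ⟨h1, h2⟩ := hr p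
    have hKI : K UpperHalfPlane.I = 0 := by simp [K]
    rw [hhp, hKI, hypT_I] at h1 h2
    have hT : hypT (h • g • p) = Real.cosh r := by rw [Real.cosh_eq]; linarith
    have hd := cosh_dist_eq_hyp (h • g • p) (h • p)
    rw [dist_smul, hhp] at hd
    simp only [hypT_I, hypU_I, hypV_I, mul_zero, mul_one, sub_zero] at hd
    rw [hT] at hd
    have := Real.cosh_le_cosh.mp hd.le
    rw [abs_of_nonneg dist_nonneg] at this
    exact (hmin g hg hg1).trans this
  set E := Real.exp ε with hE
  have hE1 : 1 < E := Real.one_lt_exp_iff.mpr hε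
  -- The strip used below is 1 < (T + K)/(T - K) < exp ε, that is, 0 < K/T < tanh (ε/2); η is half
  -- of that upper bound, so an ideal point with e-component η lies in the strip.
  set η := (E - 1) / (2 * (E + 1)) with hη
  have hη0 : 0 < η := div_pos (by linarith) (by linarith)
  have hη1 : η < 1 := by rw [hη, div_lt_one (by linarith)]; linarith
  have hηE : 1 + η < E * (1 - η) := by
    rw [hη]
    have : E + 1 ≠ 0 := by linarith
    rw [← sub_pos]
    have h' : E * (1 - (E - 1) / (2 * (E + 1))) - (1 + (E - 1) / (2 * (E + 1))) =
        (E - 1) * (E + 1) / (2 * (E + 1)) := by field_simp; ring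
    rw [h']
    exact div_pos (mul_pos (by linarith) (by linarith)) (by linarith)
  set ξ := √(1 - η ^ 2) with hξ
  have hξ2 : ξ ^ 2 = 1 - η ^ 2 := Real.sq_sqrt (by nlinarith)
  obtain ⟨g, hg, hg1, z, hz, hgz⟩ := exists_ne_one_of_finiteArea hF h
    (O := {q : ℝ × ℝ | 0 < e₁ * q.1 + e₂ * q.2 ∧
      1 + (e₁ * q.1 + e₂ * q.2) < E * (1 - (e₁ * q.1 + e₂ * q.2))})
    (by refine IsOpen.and (isOpen_lt ?_ ?_) (isOpen_lt ?_ ?_) <;> fun_prop)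
    (u := (η * e₁ - ξ * e₂, η * e₂ + ξ * e₁))
    (by
      have : e₁ * (η * e₁ - ξ * e₂) + e₂ * (η * e₂ + ξ * e₁) = η := by
        linear_combination η * he
      simp only [Set.mem_ofPred_eq, this]
      exact ⟨hη0, hηE⟩)
    (by simp only; linear_combination (η ^ 2 + ξ ^ 2) * he + hξ2)
  have hin : ∀ z : ℍ, klein (z : ℍ) ∈ {q : ℝ × ℝ | 0 < e₁ * q.1 + e₂ * q.2 ∧
      1 + (e₁ * q.1 + e₂ * q.2) < E * (1 - (e₁ * q.1 + e₂ * q.2))} →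
      0 < hypT z - K z ∧ hypT z - K z < hypT z + K z ∧ hypT z + K z < E * (hypT z - K z) := by
    intro z hz
    have hT := hypT_pos z
    rw [klein_coe] at hz
    have hK : e₁ * (hypU z / hypT z) + e₂ * (hypV z / hypT z) = K z / hypT z := by
      simp only [K]; ring
    simp only [Set.mem_ofPred_eq, hK] at hz
    obtain ⟨h1, h2⟩ := hz
    have hK0 : 0 < K z := (div_pos_iff_of_pos_right hT).mp h1
    have h3 : hypT z + K z < E * (hypT z - K z) := by
      have := mul_lt_mul_of_pos_right h2 hT
      have e : K z / hypT z * hypT z = K z := div_mul_cancel₀ _ hT.ne'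
      linear_combination this + (-1 - E) * e
    refine ⟨?_, by linarith, h3⟩
    by_contra! hle
    nlinarith
  obtain ⟨r, hr⟩ := htrans g hg
  have hrε := hlong g hg hg1 r hr
  obtain ⟨a0, a1, a2⟩ := hin _ hz
  obtain ⟨b0, b1, b2⟩ := hin _ hgz
  rw [(hr z).1, (hr z).2] at b1 b2
  set P := hypT (h • z) + K (h • z)
  set Q := hypT (h • z) - K (h • z)
  -- `g` multiplies the ratio (T + K)/(T - K) by exp (2r) with |r| ≥ ε, which is too much for both
  -- points to have ratio between 1 and exp ε.
  rcases le_abs.mp hrε with hr' | hr'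
  · have h1 : E * Real.exp (-r) ≤ Real.exp r := by
      rw [hE, ← Real.exp_add]
      exact Real.exp_le_exp.mpr (by linarith)
    have : E * Real.exp (-r) * Q ≤ Real.exp r * P :=
      mul_le_mul h1 a1.le a0.le (Real.exp_pos _).le
    linarith
  · have h1 : E * Real.exp r ≤ Real.exp (-r) := by
      rw [hE, ← Real.exp_add]
      exact Real.exp_le_exp.mpr (by linarith)
    have h2 : E * Real.exp r * Q ≤ Real.exp (-r) * Q := mul_le_mul_of_nonneg_right h1 a0.le
    have h3 : Real.exp r * P < Real.exp r * (E * Q) :=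
      mul_lt_mul_of_pos_left a2 (Real.exp_pos _)
    linarith

end Generators

end PuncturedTorus

/-! ### Conclusion -/

theorem mainTheorem11 (Γ : Subgroup SL(2, ℝ)) (hΓ : PuncturedTorus.IsHyperbolicPuncturedTorus Γ)
    (α β : ℝ → PuncturedTorus.Surface Γ) (lα lβ : ℝ)
    (hα : PuncturedTorus.IsSimpleClosedGeodesic Γ α lα)
    (hβ : PuncturedTorus.IsSimpleClosedGeodesic Γ β lβ)
    (w : PuncturedTorus.Surface Γ) (hw : PuncturedTorus.IsWeierstrassPoint Γ w)
    (s t : ℝ) (hs : α s = w) (ht : β t = w)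
    (a b : ℝ → ℍ) (ha : PuncturedTorus.IsGeodesicLift Γ α a)
    (hb : PuncturedTorus.IsGeodesicLift Γ β b) (hab : a s = b t)
    (hgen : PuncturedTorus.AreAssociatedGenerators Γ a lα b lβ) :
    Real.sinh (lα / 2) * Real.sinh (lβ / 2) * Real.sin (PuncturedTorus.angleAt a s b t) = 1 := by
  open PuncturedTorus in
  obtain ⟨A, hAΓ, B, hBΓ, hA, hB, hcl⟩ := hgen
  obtain ⟨e₁, e₂, he, hda, hboostA⟩ := exists_standard_form ha.isometry s rfl
  obtain ⟨f₁, f₂, hf, hdb, hboostB⟩ := exists_standard_form hb.isometry t hab.symm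
  have hA' := hboostA A lα hA
  have hB' := hboostB B lβ hB
  have hsin := sin_angle_sq (a s).im_pos he hf
  rw [← hda, ← hdb] at hsin
  change Real.sin (angleAt a s b t) ^ 2 = _ at hsin
  have hSα : 0 < Real.sinh (lα / 2) := Real.sinh_pos_iff.mpr (half_pos hα.length_pos)
  have hSβ : 0 < Real.sinh (lβ / 2) := Real.sinh_pos_iff.mpr (half_pos hβ.length_pos)
  have hsin0 : 0 ≤ Real.sin (angleAt a s b t) := InnerProductGeometry.sin_angle_nonneg _ _
  have hne := cross_ne_zero hcl hΓ.free hΓ.properlyDiscontinuous hΓ.finiteArea hA' hB'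
  have hle := sinh_mul_sinh_sq_le_one hcl hΓ.finiteArea hA' hB'
  have hge := one_le_sinh_mul_sinh_sq hAΓ hBΓ hΓ.free hA' hB' (by positivity)
  rw [← hsin, ← mul_pow] at hle hge
  exact (pow_eq_one_iff_of_nonneg (by positivity) two_ne_zero).mp (le_antisymm hle hge)
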